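/- Let $\mathbb{D}^d$ be the open unit polydisc in $\mathbb{C}^d$, let $f:\mathbb{D}^d\to\mathbb{C}$ be analytic with Taylor series $f(z)=\sum_{\alpha\in\mathbb{N}_0^d} f_\alpha z^\alpha$, and let $c>0$. For a $d$-tuple $T=(T_1,\dots,T_d)$ of commuting operators put $f(T)=\sum_{\alpha} f_\alpha T^\alpha$; this series converges absolutely if every $\|T_j\|<1$, and also if the $T_j$ are commuting simultaneously diagonalizable matrices whose joint eigenvalues lie in $\mathbb{D}^d$, and it is a finite sum if the $T_j$ are commuting nilpotent matrices. Define the Agler norm \[ \|f\|_A=\sup_T\|f(T)\|\in[0,\infty], \] where the supremum is taken over all $d$-tuples $T$ of commuting operators with $\|T_j\|<1$ for all $j$ on a complex Hilbert space. A matrix is regarded as an operator on $\mathbb{C}^n$ with the Euclidean norm, and it is contractive if its operator norm is at most $1$. The following are equivalent: 1. $\|f\|_A>c$; 2. there exist $n$ and a $d$-tuple $T$ of commuting contractive simultaneously diagonalizable $n\times n$ matrices, with all joint eigenvalues in $\mathbb{D}^d$, such that $\|f(T)\|>c$; 3. there exist $n$ and a $d$-tuple $M$ of commuting contractive nilpotent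 $n\times n$ matrices such that $\|f(M)\|>c$. -/

import Mathlib

open scoped ENNReal

universe u

namespace AglerNorm

/-- The open unit polydisc `𝔻^d` in `ℂ^d`. -/
def polydisc (d : ℕ) : Set (Fin d → ℂ) := {z | ∀ j, ‖z j‖ < 1}

/-- The Taylor coefficient `f_α = (∂^α f)(0) / α!` of `f` at the origin: differentiate `α 0` times
in the first variable at `0`, divide by `(α 0)!`, and go on with the remaining variables. -/
noncomputable def taylorCoeff : (d : ℕ) → ((Fin d → ℂ) → ℂ) → (Fin d → ℕ) → ℂ
  | 0, f, _ => f 0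
  | d + 1, f, α =>
      taylorCoeff d
        (fun z : Fin d → ℂ =>
          iteratedDeriv (α 0) (fun t : ℂ => f (Fin.cons t z)) 0 / ((α 0).factorial : ℂ))
        (Fin.tail α)

/-- The monomial `T^α = T_1^{α_1} ⋯ T_d^{α_d}`. -/
def tupleMonomial {A : Type*} [Monoid A] {d : ℕ} (T : Fin d → A) (α : Fin d → ℕ) : A :=
  (List.ofFn fun j => T j ^ α j).prod

/-- The functional calculus `f(T) = ∑_α f_α T^α`, where `∑_α f_α z^α` is the Taylor series of `f` at
the origin. -/
noncomputable def evalTuple {A : Type*} [NormedRing A] [NormedAlgebra ℂ A] {d : ℕ}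
    (f : (Fin d → ℂ) → ℂ) (T : Fin d → A) : A :=
  ∑' α : Fin d → ℕ, taylorCoeff d f α • tupleMonomial T α

/-- The members of the tuple commute with each other. -/
def IsCommuting {A : Type*} [Monoid A] {d : ℕ} (T : Fin d → A) : Prop :=
  ∀ i j, Commute (T i) (T j)

/-- The Agler norm of `f`, a value in `[0, ∞]`: the supremum of `‖f(T)‖` over all `d`-tuples `T` of
commuting strictly contractive operators on a complex Hilbert space. -/
noncomputable def aglerNorm {d : ℕ} (f : (Fin d → ℂ) → ℂ) : ℝ≥0∞ :=
  ⨆ (H : Type u) (_ : NormedAddCommGroup H) (_ : InnerProductSpace ℂ H) (_ : CompleteSpace H)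
    (T : Fin d → (H →L[ℂ] H)) (_ : IsCommuting T) (_ : ∀ j, ‖T j‖ < 1), ‖evalTuple f T‖ₑ

/-- The algebra of `n × n` complex matrices, acting as operators on `ℂ^n` with its Euclidean norm,
so that `‖·‖` is the operator norm. -/
abbrev MatOp (n : ℕ) : Type := EuclideanSpace ℂ (Fin n) →L[ℂ] EuclideanSpace ℂ (Fin n)

/-- There is a basis of `ℂ^n` consisting of joint eigenvectors of the tuple. -/
def IsSimultaneouslyDiagonalizable {d n : ℕ} (T : Fin d → MatOp n) : Prop :=
  ∃ (b : Module.Basis (Fin n) ℂ (EuclideanSpace ℂ (Fin n))) (μ : Fin n → Fin d → ℂ),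
    ∀ i j, T j (b i) = μ i j • b i

/-- The joint spectrum `σ(T)` of a tuple of commuting matrices: the set of its joint eigenvalues. -/
def jointSpectrum {d n : ℕ} (T : Fin d → MatOp n) : Set (Fin d → ℂ) :=
  {μ | ∃ v : EuclideanSpace ℂ (Fin n), v ≠ 0 ∧ ∀ j, T j v = μ j • v}

end AglerNorm

namespace AglerNorm

open Filter Topology

/-! Conditions 2 and 3 each give 1 by radial approximation: if the series for `f(T)` converges
absolutely, then `f(sT)` tends to `f(T)` as `s` increases to 1, and the `sT_j` are commuting strict
contractions (`ofReal_lt_aglerNorm`).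

For the converse, take commuting `T_j` with `‖T_j‖ ≤ ρ < 1` and a vector `v` with `‖f(T)v‖ > c‖v‖`.
On polynomials `g` of degree at most `N` in each variable, put the Hilbert norm whose square is
`∑_{k ≤ N} ‖g_{≤k}(T)v‖² + ∑_α ρ^{2|α|} |g_α|² ‖v‖²`, where `g_{≤k}` is the part of total degree at
most `k`. Truncated multiplication `S_j` by `z_j` is nilpotent. It has norm at most `ρ`, because
`(S_j g)_{≤k+1}(T) = T_j g_{≤k}(T)` for `k < N`. The constant 1 has squared norm `(N+2)‖v‖²`, while
that of `f(S)1` is at least `∑_{k ≤ N} ‖f_{≤k}(T)v‖²`. These terms tend to `‖f(T)v‖²`, so by Cesàro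
averaging `‖f(S)1‖ > c‖1‖` for some `N` (`exists_gridShift_model`). This gives 3.

For 2, add to each `S_j` the diagonal operator with entries `t α_j`. The operators still commute,
have distinct joint eigenvalues `tβ` when `t ≠ 0`, and converge to `S` as `t → 0`. Continuity of the
functional calculus preserves the strict inequality (`exists_isSimultaneouslyDiagonalizable`). -/

/-! ### Taylor coefficients and Cauchy estimates on the polydisc. -/

theorem isOpen_polydisc (d : ℕ) : IsOpen (polydisc d) := by
  simp only [polydisc, Set.ofPred_forall]
  exact isOpen_iInter_of_finite fun j => isOpen_lt (by fun_prop) continuous_const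

theorem cons_mem_polydisc {d : ℕ} {t : ℂ} {z : Fin d → ℂ} (ht : ‖t‖ < 1) (hz : z ∈ polydisc d) :
    (Fin.cons t z : Fin (d + 1) → ℂ) ∈ polydisc (d + 1) := fun j => by
  cases j using Fin.cases with
  | zero => simpa using ht
  | succ i => simpa using hz i

/-- The map `(t, z) ↦ Fin.cons t z` is affine in `t`, with derivative the first basis vector. -/
theorem hasDerivAt_cons {d : ℕ} (z : Fin d → ℂ) (t : ℂ) :
    HasDerivAt (fun t : ℂ => (Fin.cons t z : Fin (d + 1) → ℂ)) (Fin.cons 1 0) t := by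
  rw [hasDerivAt_pi]
  intro j
  cases j using Fin.cases with
  | zero => simp only [Fin.cons_zero]; exact hasDerivAt_id' t
  | succ i => simpa using hasDerivAt_const t (z i)

theorem analyticOnNhd_cons {d : ℕ} (t : ℂ) (s : Set (Fin d → ℂ)) :
    AnalyticOnNhd ℂ (fun z : Fin d → ℂ => (Fin.cons t z : Fin (d + 1) → ℂ)) s := by
  intro z _
  rw [analyticAt_pi_iff]
  intro j
  cases j using Fin.cases with
  | zero => simpa using analyticAt_const
  | succ i =>
    simp only [Fin.cons_succ]
    exact (ContinuousLinearMap.proj (R := ℂ) (φ := fun _ : Fin d => ℂ) i).analyticAt z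

/-- Iterated derivatives in the first variable are analytic in the remaining ones. -/
theorem analyticOnNhd_iteratedDeriv_cons {d : ℕ} {f : (Fin (d + 1) → ℂ) → ℂ}
    (hf : AnalyticOnNhd ℂ f (polydisc (d + 1))) (n : ℕ) :
    AnalyticOnNhd ℂ (fun z : Fin d → ℂ => iteratedDeriv n (fun t : ℂ => f (Fin.cons t z)) 0)
      (polydisc d) := by
  -- The induction needs the derivative at every `t` in the disc, not only at 0, as one function
  -- jointly analytic in `(t, z)`.
  have key : ∃ F : (Fin (d + 1) → ℂ) → ℂ, AnalyticOnNhd ℂ F (polydisc (d + 1)) ∧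
      ∀ z ∈ polydisc d, ∀ t : ℂ, ‖t‖ < 1 →
        iteratedDeriv n (fun t : ℂ => f (Fin.cons t z)) t = F (Fin.cons t z) := by
    induction n with
    | zero => exact ⟨f, hf, fun z _ t _ => by simp⟩
    | succ n ih =>
      obtain ⟨F, hF, h⟩ := ih
      refine ⟨fun w => fderiv ℂ F w (Fin.cons 1 0), fun w hw => ?_, fun z hz t ht => ?_⟩
      · exact ((ContinuousLinearMap.apply ℂ ℂ (Fin.cons 1 0 : Fin (d + 1) → ℂ)).analyticAt _).comp
          (hF.fderiv w hw)
      · have hev : iteratedDeriv n (fun t : ℂ => f (Fin.cons t z)) =ᶠ[𝓝 t]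
            fun t => F (Fin.cons t z) := by
          filter_upwards [(isOpen_lt continuous_norm continuous_const).mem_nhds ht] with s hs
            using h z hz s hs
        rw [iteratedDeriv_succ, hev.deriv_eq]
        exact ((hF _ (cons_mem_polydisc ht hz)).differentiableAt.hasFDerivAt.comp_hasDerivAt t
          (hasDerivAt_cons z t)).deriv
  obtain ⟨F, hF, h⟩ := key
  refine (hF.comp (analyticOnNhd_cons 0 (polydisc d))
    fun z hz => cons_mem_polydisc (by simp) hz).congr (isOpen_polydisc d) fun z hz => ?_
  exact (h z hz 0 (by simp)).symm

/-- Cauchy's estimates on a polydisc. -/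
theorem norm_taylorCoeff_le {r C : ℝ} (hr : 0 < r) (hr1 : r < 1) :
    ∀ {d : ℕ} {f : (Fin d → ℂ) → ℂ}, AnalyticOnNhd ℂ f (polydisc d) →
      (∀ z : Fin d → ℂ, (∀ j, ‖z j‖ ≤ r) → ‖f z‖ ≤ C) →
      ∀ α, ‖taylorCoeff d f α‖ ≤ C * ∏ j, (r⁻¹) ^ α j := by
  intro d
  induction d generalizing C with
  | zero => intro f _ hC α; simpa [taylorCoeff] using hC 0 (by simp)
  | succ d ih =>
    intro f hf hC α
    rw [taylorCoeff, Fin.prod_univ_succ, ← mul_assoc]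
    -- The one-variable Cauchy estimate in the first variable supplies the new constant for the
    -- remaining ones.
    refine ih (C := C * r⁻¹ ^ α 0) ?_ ?_ (Fin.tail α)
    · simp only [div_eq_mul_inv]
      exact (analyticOnNhd_iteratedDeriv_cons hf _).mul analyticOnNhd_const
    · intro z hz
      have hz' : z ∈ polydisc d := fun j => (hz j).trans_lt hr1
      have hd : DifferentiableOn ℂ (fun t : ℂ => f (Fin.cons t z)) (Metric.closedBall 0 r) := by
        intro t ht
        have ht1 : ‖t‖ < 1 := (by simpa using ht : ‖t‖ ≤ r).trans_lt hr1
        exact ((hf _ (cons_mem_polydisc ht1 hz')).differentiableAt.comp t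
          (hasDerivAt_cons z t).differentiableAt).differentiableWithinAt
      have hb := Complex.norm_iteratedDeriv_le_of_forall_mem_sphere_norm_le (α 0) hr
        (hd.diffContOnCl_ball subset_rfl) (C := C) (fun t ht => hC _ fun j => by
          cases j using Fin.cases with
          | zero => simpa using (mem_sphere_zero_iff_norm.1 ht).le
          | succ i => simpa using hz i)
      rw [norm_div, Complex.norm_natCast, div_le_iff₀ (by positivity)]
      refine hb.trans_eq ?_
      rw [inv_pow]; ring

theorem summable_prod_pow {s : ℝ} (hs : 0 ≤ s) (hs1 : s < 1) (d : ℕ) :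
    Summable fun α : Fin d → ℕ => ∏ j, s ^ α j := by
  induction d with
  | zero => exact Summable.of_finite
  | succ d ih =>
    rw [← (Fin.consEquiv fun _ : Fin (d + 1) => ℕ).summable_iff]
    have := (summable_geometric_of_lt_one hs hs1).mul_of_nonneg ih
      (fun n => by positivity) (fun α => by positivity)
    refine this.congr fun p => ?_
    simp [Fin.prod_univ_succ, Fin.consEquiv]

/-- The Taylor series of a function analytic on the open polydisc converges absolutely there. -/
theorem summable_norm_taylorCoeff_mul {d : ℕ} {f : (Fin d → ℂ) → ℂ}
    (hf : AnalyticOnNhd ℂ f (polydisc d)) {r : ℝ} (hr : 0 ≤ r) (hr1 : r < 1) :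
    Summable fun α : Fin d → ℕ => ‖taylorCoeff d f α‖ * ∏ j, r ^ α j := by
  -- Cauchy's estimates on the larger radius `R` leave a geometric series of ratio `r / R`.
  obtain ⟨R, hrR, hR1⟩ := exists_between hr1
  have hR : 0 < R := hr.trans_lt hrR
  have hK : IsCompact (Metric.closedBall (0 : Fin d → ℂ) R) := isCompact_closedBall _ _
  obtain ⟨C, hC⟩ := hK.exists_bound_of_continuousOn (f := f) (hf.continuousOn.mono fun z hz j =>
    ((norm_le_pi_norm z j).trans (mem_closedBall_zero_iff.1 hz)).trans_lt hR1)
  have hcoeff := norm_taylorCoeff_le hR hR1 hf (C := C) fun z hz =>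
    hC z (mem_closedBall_zero_iff.2 ((pi_norm_le_iff_of_nonneg hR.le).2 hz))
  refine Summable.of_nonneg_of_le (fun α => by positivity) (fun α => ?_)
    ((summable_prod_pow (s := R⁻¹ * r) (by positivity) ?_ d).mul_left C)
  · refine (mul_le_mul_of_nonneg_right (hcoeff α) (by positivity)).trans_eq ?_
    rw [mul_assoc, ← Finset.prod_mul_distrib]
    simp_rw [mul_pow]
  · rw [inv_mul_lt_one₀ hR]; exact hrR

/-! ### Monomials in a tuple. -/

theorem tupleMonomial_succ {A : Type*} [Monoid A] {d : ℕ} (T : Fin (d + 1) → A)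
    (α : Fin (d + 1) → ℕ) :
    tupleMonomial T α = T 0 ^ α 0 * tupleMonomial (Fin.tail T) (Fin.tail α) := by
  simp [tupleMonomial, List.ofFn_succ, Fin.tail]

theorem map_tupleMonomial {A B F : Type*} [Monoid A] [Monoid B] [FunLike F A B]
    [MonoidHomClass F A B] (φ : F) {d : ℕ} (T : Fin d → A) (α : Fin d → ℕ) :
    φ (tupleMonomial T α) = tupleMonomial (fun j => φ (T j)) α := by
  simp [tupleMonomial, map_list_prod, List.map_ofFn, Function.comp_def]

theorem tupleMonomial_update_add_one {A : Type*} [Monoid A] {d : ℕ} {T : Fin d → A}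
    (hT : IsCommuting T) (α : Fin d → ℕ) (j : Fin d) :
    tupleMonomial T (Function.update α j (α j + 1)) = T j * tupleMonomial T α := by
  induction d with
  | zero => exact j.elim0
  | succ d ih =>
    rw [tupleMonomial_succ, tupleMonomial_succ T α]
    cases j using Fin.cases with
    | zero => simp [pow_succ', mul_assoc]
    | succ i =>
      have h : Fin.tail (Function.update α i.succ (α i.succ + 1)) =
          Function.update (Fin.tail α) i (Fin.tail α i + 1) := by
        rw [Fin.tail_update_succ]; rfl
      have hT' : IsCommuting (Fin.tail T) := fun a b => hT a.succ b.succ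
      rw [h, ih hT', Function.update_of_ne (Fin.succ_ne_zero i).symm, ← mul_assoc, ← mul_assoc]
      congr 1
      exact ((hT i.succ 0).pow_right _).eq.symm

theorem tupleMonomial_smul {A : Type*} [Ring A] [Algebra ℂ A] {d : ℕ} (s : ℂ) (T : Fin d → A)
    (α : Fin d → ℕ) :
    tupleMonomial (fun j => s • T j) α = (∏ j, s ^ α j) • tupleMonomial T α := by
  induction d with
  | zero => simp [tupleMonomial]
  | succ d ih =>
    rw [tupleMonomial_succ, tupleMonomial_succ T, Fin.prod_univ_succ]
    have := ih (Fin.tail T) (Fin.tail α)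
    simp only [Fin.tail_def] at this ⊢
    rw [this, smul_pow, smul_mul_smul_comm]

theorem tupleMonomial_eq_zero {A : Type*} [Ring A] {d : ℕ} {T : Fin d → A} {α : Fin d → ℕ}
    {j : Fin d} (h : T j ^ α j = 0) : tupleMonomial T α = 0 := by
  rw [tupleMonomial]
  exact List.prod_eq_zero (List.mem_ofFn.2 ⟨j, h⟩)

/-- Assuming `‖1‖ ≤ 1` rather than `‖1‖ = 1` admits operators on the zero space. -/
theorem norm_tupleMonomial_le {A : Type*} [NormedRing A] (h1 : ‖(1 : A)‖ ≤ 1) {r : ℝ}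
    {d : ℕ} {T : Fin d → A} (hT : ∀ j, ‖T j‖ ≤ r) (α : Fin d → ℕ) :
    ‖tupleMonomial T α‖ ≤ ∏ j, r ^ α j := by
  induction d with
  | zero => simpa [tupleMonomial] using h1
  | succ d ih =>
    have hr : 0 ≤ r := (norm_nonneg _).trans (hT 0)
    have hp : ∀ n : ℕ, ‖T 0 ^ n‖ ≤ r ^ n := by
      intro n
      induction n with
      | zero => simpa using h1
      | succ n ihn =>
        rw [pow_succ, pow_succ]
        exact (norm_mul_le _ _).trans (mul_le_mul ihn (hT 0) (norm_nonneg _) (by positivity))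
    rw [tupleMonomial_succ, Fin.prod_univ_succ]
    exact (norm_mul_le _ _).trans (mul_le_mul (hp _) (ih (T := Fin.tail T) (fun j => hT j.succ) _)
      (norm_nonneg _) (by positivity))

theorem continuous_tupleMonomial {A : Type*} [NormedRing A] {d : ℕ} (α : Fin d → ℕ) :
    Continuous fun T : Fin d → A => tupleMonomial T α := by
  induction d with
  | zero => simpa [tupleMonomial] using continuous_const
  | succ d ih =>
    simp_rw [tupleMonomial_succ]
    exact ((continuous_apply 0).pow _).mul
      ((ih (Fin.tail α)).comp (by unfold Fin.tail; fun_prop))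

/-- A joint eigenvector is an eigenvector of every monomial. -/
theorem tupleMonomial_apply_of_eigenvector {V : Type*} [NormedAddCommGroup V] [NormedSpace ℂ V]
    {d : ℕ} {T : Fin d → V →L[ℂ] V} {μ : Fin d → ℂ} {v : V} (h : ∀ j, T j v = μ j • v)
    (α : Fin d → ℕ) : tupleMonomial T α v = (∏ j, μ j ^ α j) • v := by
  induction d with
  | zero => simp [tupleMonomial]
  | succ d ih =>
    have hp : ∀ n : ℕ, (T 0 ^ n) v = μ 0 ^ n • v := by
      intro n
      induction n with
      | zero => simp
      | succ n ihn => rw [pow_succ, mul_apply_eq_comp, h 0, map_smul, ihn, smul_smul,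
          pow_succ']
    rw [tupleMonomial_succ, mul_apply_eq_comp,
      ih (T := Fin.tail T) (μ := Fin.tail μ) fun j => h j.succ, map_smul, hp, smul_smul,
      Fin.prod_univ_succ, mul_comm]
    rfl

/-! ### Convergence of the functional calculus and lower bounds for the Agler norm. -/

/-- The functional calculus is continuous on tuples of norm at most `r < 1`. -/
theorem tendsto_evalTuple {A ι : Type*} [NormedRing A] [NormedAlgebra ℂ A] [CompleteSpace A]
    (h1 : ‖(1 : A)‖ ≤ 1) {d : ℕ} {f : (Fin d → ℂ) → ℂ} (hf : AnalyticOnNhd ℂ f (polydisc d))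
    {l : Filter ι} {T : ι → Fin d → A} {S : Fin d → A} {r : ℝ} (hr : 0 ≤ r) (hr1 : r < 1)
    (hT : ∀ᶠ i in l, ∀ j, ‖T i j‖ ≤ r) (hlim : Tendsto T l (𝓝 S)) :
    Tendsto (fun i => evalTuple f (T i)) l (𝓝 (evalTuple f S)) := by
  refine tendsto_tsum_of_dominated_convergence (summable_norm_taylorCoeff_mul hf hr hr1)
    (fun α => (((continuous_tupleMonomial α).tendsto S).comp hlim).const_smul _) ?_
  filter_upwards [hT] with i hi α
  rw [norm_smul]
  exact mul_le_mul_of_nonneg_left (norm_tupleMonomial_le h1 hi α) (norm_nonneg _)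

theorem summable_evalTuple {A : Type*} [NormedRing A] [NormedAlgebra ℂ A]
    (h1 : ‖(1 : A)‖ ≤ 1) {d : ℕ} {f : (Fin d → ℂ) → ℂ} (hf : AnalyticOnNhd ℂ f (polydisc d))
    {T : Fin d → A} {r : ℝ} (hr : 0 ≤ r) (hr1 : r < 1) (hT : ∀ j, ‖T j‖ ≤ r) :
    Summable fun α => ‖taylorCoeff d f α • tupleMonomial T α‖ := by
  refine (summable_norm_taylorCoeff_mul hf hr hr1).of_nonneg_of_le (fun _ => norm_nonneg _)
    fun α => ?_
  rw [norm_smul]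
  exact mul_le_mul_of_nonneg_left (norm_tupleMonomial_le h1 hT α) (norm_nonneg _)

/-- Commuting strict contractions on `ℂ^n` are admissible in the Agler norm, in every universe. -/
theorem enorm_evalTuple_le_aglerNorm {d n : ℕ} (f : (Fin d → ℂ) → ℂ) {T : Fin d → MatOp n}
    (hT : IsCommuting T) (hT1 : ∀ j, ‖T j‖ < 1) : ‖evalTuple f T‖ₑ ≤ aglerNorm.{u} f := by
  -- Lifting the index type moves `ℂ^n` isometrically into the universe of the supremum.
  let e : EuclideanSpace ℂ (Fin n) ≃ₗᵢ[ℂ] EuclideanSpace ℂ (ULift.{u} (Fin n)) :=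
    LinearIsometryEquiv.piLpCongrLeft 2 ℂ ℂ Equiv.ulift.symm
  let φ := e.toContinuousLinearEquiv.conjContinuousAlgEquiv
  have hiso : ∀ X, ‖φ X‖ = ‖X‖ := fun X =>
    (LinearIsometry.norm_toContinuousLinearMap_comp e.toLinearIsometry).trans
      (X.opNorm_comp_linearIsometryEquiv e.symm)
  have hmap : φ (evalTuple f T) = evalTuple f fun j => φ (T j) := by
    refine (ContinuousLinearEquiv.map_tsum φ.toContinuousLinearEquiv).trans ?_
    refine tsum_congr fun α => ?_
    rw [← map_tupleMonomial φ]
    exact map_smul φ _ _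
  rw [← enorm_norm, ← hiso, enorm_norm, hmap]
  exact le_iSup_of_le (EuclideanSpace ℂ (ULift.{u} (Fin n))) <| le_iSup_of_le inferInstance <|
    le_iSup_of_le inferInstance <| le_iSup_of_le inferInstance <|
    le_iSup_of_le (fun j => φ (T j)) <| le_iSup_of_le (fun i j => (hT i j).map φ) <|
    le_iSup_of_le (fun j => by rw [hiso]; exact hT1 j) le_rfl

/-- Radial approximation: contractions may be used to bound the Agler norm from below, as long as
the series for `f(T)` converges absolutely. -/
theorem ofReal_lt_aglerNorm {d n : ℕ} {f : (Fin d → ℂ) → ℂ} {T : Fin d → MatOp n}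
    (hT : IsCommuting T) (hT1 : ∀ j, ‖T j‖ ≤ 1)
    (hsum : Summable fun α => ‖taylorCoeff d f α • tupleMonomial T α‖) {c : ℝ}
    (hc : 0 < c) (h : c < ‖evalTuple f T‖) : ENNReal.ofReal c < aglerNorm.{u} f := by
  have hlim : Tendsto (fun s : ℝ => evalTuple f fun j => (s : ℂ) • T j) (𝓝[<] 1)
      (𝓝 (evalTuple f T)) := by
    -- Scaling by `s` multiplies the term at `α` by `s^|α| ≤ 1`, so the series at `T` itself
    -- dominates.
    refine tendsto_tsum_of_dominated_convergence hsum (fun α => ?_) ?_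
    · have hcont : Continuous fun s : ℝ => taylorCoeff d f α •
          tupleMonomial (fun j => (s : ℂ) • T j) α :=
        (continuous_const_smul (taylorCoeff d f α)).comp <|
          (continuous_tupleMonomial α).comp (f := fun s : ℝ => fun j => (s : ℂ) • T j) (by fun_prop)
      simpa using (hcont.tendsto 1).mono_left nhdsWithin_le_nhds
    · filter_upwards [Ioo_mem_nhdsLT (zero_lt_one' ℝ)] with s hs α
      rw [show tupleMonomial (fun j => (s : ℂ) • T j) α = _ from tupleMonomial_smul _ T α,
        smul_comm, norm_smul]
      refine mul_le_of_le_one_left (norm_nonneg _) ?_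
      rw [norm_prod]
      refine Finset.prod_le_one (fun _ _ => norm_nonneg _) fun j _ => ?_
      rw [norm_pow, Complex.norm_of_nonneg hs.1.le]
      exact pow_le_one₀ hs.1.le hs.2.le
  obtain ⟨s, hs, hs1⟩ := ((hlim.norm.eventually_const_lt h).and
    (Ioo_mem_nhdsLT (zero_lt_one' ℝ))).exists
  refine lt_of_lt_of_le ?_ (enorm_evalTuple_le_aglerNorm f (T := fun j => (s : ℂ) • T j)
    (fun i j => ((hT i j).smul_left _).smul_right _) fun j => ?_)
  · rw [← ofReal_norm]
    exact (ENNReal.ofReal_lt_ofReal_iff (hc.trans hs)).2 hs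
  · rw [norm_smul, Complex.norm_of_nonneg hs1.1.le]
    exact (mul_le_of_le_one_right hs1.1.le (hT1 j)).trans_lt hs1.2

theorem summable_evalTuple_of_isNilpotent {A : Type*} [NormedRing A] [NormedAlgebra ℂ A] {d : ℕ}
    (f : (Fin d → ℂ) → ℂ) {T : Fin d → A} (hT : ∀ j, IsNilpotent (T j)) :
    Summable fun α => ‖taylorCoeff d f α • tupleMonomial T α‖ := by
  choose k hk using hT
  refine summable_of_hasFiniteSupport ((Set.finite_Iic k).subset fun α hα => ?_)
  simp only [Function.mem_support, ne_eq, norm_eq_zero] at hα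
  intro j
  by_contra! hj
  exact hα (by rw [tupleMonomial_eq_zero (pow_eq_zero_of_le hj.le (hk j)), smul_zero])

/-- Finitely many numbers less than one are bounded by a positive number less than one. -/
theorem exists_uniform_bound_lt_one {ι : Type*} [Finite ι] {x : ι → ℝ} (hx : ∀ i, x i < 1) :
    ∃ r : ℝ, 0 < r ∧ r < 1 ∧ ∀ i, x i ≤ r := by
  have h : ∀ᶠ r in 𝓝[<] (1 : ℝ), ∀ i, x i ≤ r := eventually_all.2 fun i => by
    filter_upwards [Ioo_mem_nhdsLT (hx i)] with r hr using hr.1.le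
  obtain ⟨r, hr, h01⟩ := (h.and (Ioo_mem_nhdsLT (zero_lt_one' ℝ))).exists
  exact ⟨r, h01.1, h01.2, hr⟩

theorem summable_evalTuple_of_isSimultaneouslyDiagonalizable {d n : ℕ} {f : (Fin d → ℂ) → ℂ}
    (hf : AnalyticOnNhd ℂ f (polydisc d)) {T : Fin d → MatOp n}
    (hT : IsSimultaneouslyDiagonalizable T) (hσ : jointSpectrum T ⊆ polydisc d) :
    Summable fun α => ‖taylorCoeff d f α • tupleMonomial T α‖ := by
  obtain ⟨b, μ, h⟩ := hT
  have hμ : ∀ i, μ i ∈ polydisc d := fun i => hσ ⟨b i, b.ne_zero i, h i⟩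
  obtain ⟨r, hr0, hr1, hr⟩ := exists_uniform_bound_lt_one
    (x := fun p : Fin n × Fin d => ‖μ p.1 p.2‖) fun p => hμ p.1 p.2
  obtain ⟨C, hC, hbound⟩ := b.exists_opNorm_le (F := EuclideanSpace ℂ (Fin n))
  obtain ⟨B, hB⟩ := (Set.finite_range fun i => ‖b i‖).bddAbove
  refine ((summable_norm_taylorCoeff_mul hf hr0.le hr1).mul_left (C * max B 0)).of_nonneg_of_le
    (fun _ => norm_nonneg _) fun α => ?_
  -- An operator norm is controlled, up to a constant, by the values on the eigenbasis, where
  -- monomials act by scalars of modulus at most `r^|α|`.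
  have hα : ‖tupleMonomial T α‖ ≤ C * (max B 0 * ∏ j, r ^ α j) := by
    refine hbound (by positivity) fun i => ?_
    rw [tupleMonomial_apply_of_eigenvector (h i), norm_smul, norm_prod, mul_comm]
    refine mul_le_mul ((hB ⟨i, rfl⟩).trans (le_max_left _ _)) ?_ (by positivity) (by positivity)
    refine Finset.prod_le_prod (fun _ _ => norm_nonneg _) fun j _ => ?_
    rw [norm_pow]
    exact pow_le_pow_left₀ (norm_nonneg _) (hr (i, j)) _
  rw [norm_smul]
  exact (mul_le_mul_of_nonneg_left hα (norm_nonneg _)).trans_eq (by ring)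

/-! ### Truncated coordinate shifts and their diagonalizable perturbations. -/

/-- Decrease the `j`-th entry of a multi-index by one. -/
def lower {d N : ℕ} (j : Fin d) (α : Fin d → Fin (N + 1)) : Fin d → Fin (N + 1) :=
  Function.update α j ⟨(α j : ℕ) - 1, (Nat.sub_le _ _).trans_lt (α j).2⟩

@[simp] theorem lower_same {d N : ℕ} (j : Fin d) (α : Fin d → Fin (N + 1)) :
    (lower j α j : ℕ) = (α j : ℕ) - 1 := by
  simp [lower]

@[simp] theorem lower_of_ne {d N : ℕ} {i j : Fin d} (h : i ≠ j) (α : Fin d → Fin (N + 1)) :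
    lower j α i = α i := by
  simp [lower, h]

theorem lower_comm {d N : ℕ} {i j : Fin d} (h : i ≠ j) (α : Fin d → Fin (N + 1)) :
    lower i (lower j α) = lower j (lower i α) := by
  simp only [lower, Function.update_of_ne h, Function.update_of_ne h.symm]
  exact Function.update_comm h.symm _ _ _

/-- The perturbed coordinate shifts on functions on a box. They are the operators of multiplication
by the coordinates in the Newton basis attached to the grid `t ℕ^d`. -/
def gridShift (d N : ℕ) (t : ℂ) (j : Fin d) : Module.End ℂ ((Fin d → Fin (N + 1)) → ℂ) where
  toFun g α := (if (α j : ℕ) = 0 then 0 else g (lower j α)) + t * (α j : ℕ) * g α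
  map_add' g h := by
    ext α
    simp only [Pi.add_apply]
    split_ifs <;> ring
  map_smul' c g := by
    ext α
    simp only [Pi.smul_apply, smul_eq_mul, RingHom.id_apply]
    split_ifs <;> ring

theorem gridShift_apply {d N : ℕ} (t : ℂ) (j : Fin d) (g : (Fin d → Fin (N + 1)) → ℂ)
    (α : Fin d → Fin (N + 1)) :
    gridShift d N t j g α =
      (if (α j : ℕ) = 0 then 0 else g (lower j α)) + t * (α j : ℕ) * g α := rfl

theorem gridShift_commute {d N : ℕ} (t : ℂ) (i j : Fin d) :
    Commute (gridShift d N t i) (gridShift d N t j) := by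
  rcases eq_or_ne i j with rfl | h
  · exact Commute.refl _
  · refine LinearMap.ext fun g => funext fun α => ?_
    simp only [Module.End.mul_apply, gridShift_apply, lower_of_ne h, lower_of_ne h.symm,
      lower_comm h]
    split_ifs <;> ring

theorem gridShift_zero_pow {d N : ℕ} (j : Fin d) (m : ℕ) (g : (Fin d → Fin (N + 1)) → ℂ)
    (α : Fin d → Fin (N + 1)) (h : (α j : ℕ) < m) : (gridShift d N 0 j ^ m) g α = 0 := by
  induction m generalizing α with
  | zero => exact absurd h (Nat.not_lt_zero _)
  | succ m ih =>
    rw [pow_succ', Module.End.mul_apply, gridShift_apply]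
    split_ifs with h0
    · simp
    · rw [ih _ (by rw [lower_same]; omega)]
      simp

theorem isNilpotent_gridShift_zero {d N : ℕ} (j : Fin d) : IsNilpotent (gridShift d N 0 j) :=
  ⟨N + 1, LinearMap.ext fun g => funext fun α => gridShift_zero_pow j _ g α (α j).2⟩

/-- Being affine in `t`, the shifts depend continuously on `t` in any operator norm. -/
theorem gridShift_eq_add_smul {d N : ℕ} (t : ℂ) (j : Fin d) :
    gridShift d N t j = gridShift d N 0 j + t • (gridShift d N 1 j - gridShift d N 0 j) := by
  refine LinearMap.ext fun g => funext fun α => ?_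
  simp only [LinearMap.add_apply, LinearMap.smul_apply, LinearMap.sub_apply, Pi.add_apply,
    Pi.smul_apply, Pi.sub_apply, gridShift_apply, smul_eq_mul]
  ring

/-- The entries of the eigenvectors of the one-variable perturbed shift. -/
noncomputable def eigenvectorEntry (t : ℂ) (b a : ℕ) : ℂ :=
  if b ≤ a then (-t⁻¹) ^ (a - b) / (a - b).factorial else 0

/-- This is the one-variable eigenvalue equation; for `a > b` it reads `x_{a-1} = -t (a - b) x_a`,
which forces the factorial formula from `x_b = 1`. -/
theorem eigenvectorEntry_recurrence {t : ℂ} (ht : t ≠ 0) (b a : ℕ) :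
    (if a = 0 then 0 else eigenvectorEntry t b (a - 1)) + t * a * eigenvectorEntry t b a =
      t * b * eigenvectorEntry t b a := by
  unfold eigenvectorEntry
  rcases lt_trichotomy a b with h | rfl | h
  · rw [if_neg (show ¬ b ≤ a - 1 by omega), if_neg (show ¬ b ≤ a by omega)]
    simp
  · rcases Nat.eq_zero_or_pos a with rfl | ha
    · simp
    · rw [if_neg (show ¬ a ≤ a - 1 by omega)]
      simp
  · obtain ⟨m, rfl⟩ := Nat.exists_eq_add_of_lt h
    rw [if_neg (by omega), if_pos (by omega), if_pos (by omega),
      show b + m + 1 - 1 - b = m by omega, show b + m + 1 - b = m + 1 by omega,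
      Nat.factorial_succ, pow_succ]
    have hm : ((m : ℂ) + 1) ≠ 0 := Nat.cast_add_one_ne_zero m
    have hf : (m.factorial : ℂ) ≠ 0 := Nat.cast_ne_zero.2 m.factorial_ne_zero
    push_cast
    field_simp
    ring

/-- The joint eigenvectors of the perturbed shifts. -/
noncomputable def gridEigenvector {d N : ℕ} (t : ℂ) (β : Fin d → Fin (N + 1)) :
    (Fin d → Fin (N + 1)) → ℂ :=
  fun α => ∏ j, eigenvectorEntry t (β j) (α j)

theorem gridShift_gridEigenvector {d N : ℕ} {t : ℂ} (ht : t ≠ 0) (β : Fin d → Fin (N + 1))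
    (j : Fin d) : gridShift d N t j (gridEigenvector t β) =
      (t * (β j : ℕ)) • gridEigenvector t β := by
  funext α
  have h1 : gridEigenvector t β (lower j α) = eigenvectorEntry t (β j) ((α j : ℕ) - 1) *
      ∏ i ∈ Finset.univ.erase j, eigenvectorEntry t (β i) (α i) := by
    rw [gridEigenvector, ← Finset.mul_prod_erase _ _ (Finset.mem_univ j), lower_same]
    congr 1
    exact Finset.prod_congr rfl fun i hi => by rw [lower_of_ne (Finset.ne_of_mem_erase hi)]
  have h2 : gridEigenvector t β α = eigenvectorEntry t (β j) (α j) *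
      ∏ i ∈ Finset.univ.erase j, eigenvectorEntry t (β i) (α i) := by
    rw [gridEigenvector, ← Finset.mul_prod_erase _ _ (Finset.mem_univ j)]
  rw [gridShift_apply, Pi.smul_apply, smul_eq_mul, h1, h2, ← mul_assoc, ← mul_assoc,
    ← eigenvectorEntry_recurrence ht]
  split_ifs <;> ring

theorem gridEigenvector_ne_zero {d N : ℕ} (t : ℂ) (β : Fin d → Fin (N + 1)) :
    gridEigenvector t β ≠ 0 := fun h => by
  simpa [gridEigenvector, eigenvectorEntry] using congrFun h β

/-- Joint generalized eigenspaces of a commuting family are independent, and the joint eigenvalues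
`tβ` are distinct for `t ≠ 0`. -/
theorem linearIndependent_gridEigenvector {d N : ℕ} {t : ℂ} (ht : t ≠ 0) :
    LinearIndependent ℂ (gridEigenvector (d := d) (N := N) t) := by
  have hind := Module.End.independent_iInf_maxGenEigenspace_of_forall_mapsTo (gridShift d N t)
    fun i j μ => Module.End.mapsTo_maxGenEigenspace_of_comm (gridShift_commute t j i) μ
  refine (hind.comp (f := fun (β : Fin d → Fin (N + 1)) j => t * ((β j : ℕ) : ℂ))
    fun β γ h => ?_).linearIndependent _ (fun β => ?_) (gridEigenvector_ne_zero t)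
  · funext j
    have := mul_left_cancel₀ ht (congrFun h j)
    exact Fin.ext (Nat.cast_injective this)
  · refine (Submodule.mem_iInf _).2 fun j => ?_
    exact Module.End.mem_maxGenEigenspace _ _ _ |>.2 ⟨1, by
      simp [gridShift_gridEigenvector ht]⟩

/-- The joint eigenbasis of the perturbed shifts. -/
noncomputable def gridEigenbasis (d N : ℕ) {t : ℂ} (ht : t ≠ 0) :
    Module.Basis (Fin d → Fin (N + 1)) ℂ ((Fin d → Fin (N + 1)) → ℂ) :=
  basisOfLinearIndependentOfCardEqFinrank (linearIndependent_gridEigenvector ht) (by simp)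

/-! ### Transport to matrices. -/

/-- Conjugation by a linear equivalence carries endomorphisms to operators on `ℂ^n`. -/
noncomputable def toMatOp {E : Type*} [AddCommGroup E] [Module ℂ E] {n : ℕ}
    (e : E ≃ₗ[ℂ] EuclideanSpace ℂ (Fin n)) : Module.End ℂ E →ₐ[ℂ] MatOp n :=
  ((e.conjAlgEquiv ℂ).trans
    (Module.End.toContinuousLinearMap (EuclideanSpace ℂ (Fin n)))).toAlgHom

@[simp] theorem toMatOp_apply {E : Type*} [AddCommGroup E] [Module ℂ E] {n : ℕ}
    (e : E ≃ₗ[ℂ] EuclideanSpace ℂ (Fin n)) (X : Module.End ℂ E) (x : EuclideanSpace ℂ (Fin n)) :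
    toMatOp e X x = e (X (e.symm x)) := rfl

theorem isSimultaneouslyDiagonalizable_gridShift {d N n : ℕ} {t : ℂ} (ht : t ≠ 0)
    (e : ((Fin d → Fin (N + 1)) → ℂ) ≃ₗ[ℂ] EuclideanSpace ℂ (Fin n)) :
    IsSimultaneouslyDiagonalizable fun j => toMatOp e (gridShift d N t j) := by
  let b := (gridEigenbasis d N ht).map e
  let ε := b.indexEquiv (EuclideanSpace.basisFun (Fin n) ℂ).toBasis
  refine ⟨b.reindex ε, fun i j => t * (ε.symm i j : ℕ), fun i j => ?_⟩
  simp [b, gridEigenbasis, gridShift_gridEigenvector ht]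

/-- A finite-dimensional subspace of a Hilbert space is isometric to some `ℂ^n`. -/
theorem exists_equiv_euclideanSpace {E K : Type*} [AddCommGroup E] [Module ℂ E]
    [FiniteDimensional ℂ E] [NormedAddCommGroup K] [InnerProductSpace ℂ K] (ι : E →ₗ[ℂ] K)
    (hι : Function.Injective ι) :
    ∃ (n : ℕ) (e : E ≃ₗ[ℂ] EuclideanSpace ℂ (Fin n)), ∀ x, ‖e x‖ = ‖ι x‖ :=
  ⟨_, (LinearEquiv.ofInjective ι hι).trans
    (stdOrthonormalBasis ℂ (LinearMap.range ι)).repr.toLinearEquiv, fun x => by simp⟩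

/-! ### Truncated evaluation at `T` intertwines the shifts with `T`. -/

/-- Increase the `j`-th entry of a multi-index by one, unless it is maximal. -/
def raise {d N : ℕ} (j : Fin d) (α : Fin d → Fin (N + 1)) : Fin d → Fin (N + 1) :=
  Function.update α j ⟨min ((α j : ℕ) + 1) N, Nat.lt_succ_of_le (min_le_right _ _)⟩

theorem raise_lower {d N : ℕ} {j : Fin d} {α : Fin d → Fin (N + 1)} (h : (α j : ℕ) ≠ 0) :
    raise j (lower j α) = α := by
  have : min ((α j : ℕ) - 1 + 1) N = α j := by have := (α j).2; omega
  simp [raise, lower, this]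

theorem lower_raise {d N : ℕ} {j : Fin d} {α : Fin d → Fin (N + 1)} (h : (α j : ℕ) < N) :
    lower j (raise j α) = α := by
  have : min ((α j : ℕ) + 1) N - 1 = α j := by omega
  simp [raise, lower, this]

theorem raise_same_ne_zero {d N : ℕ} {j : Fin d} {α : Fin d → Fin (N + 1)} (h : (α j : ℕ) < N) :
    (raise j α j : ℕ) ≠ 0 := by
  simp only [raise, Function.update_self]
  omega

theorem coe_eq_update_lower {d N : ℕ} {j : Fin d} {α : Fin d → Fin (N + 1)}
    (h : (α j : ℕ) ≠ 0) : (fun i => (α i : ℕ)) =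
      Function.update (fun i => (lower j α i : ℕ)) j ((lower j α j : ℕ) + 1) := by
  funext i
  rcases eq_or_ne i j with rfl | hi
  · rw [Function.update_self, lower_same]; omega
  · rw [Function.update_of_ne hi, lower_of_ne hi]

theorem sum_lower_add_one {d N : ℕ} {j : Fin d} {α : Fin d → Fin (N + 1)} (h : (α j : ℕ) ≠ 0) :
    ∑ i, (lower j α i : ℕ) + 1 = ∑ i, (α i : ℕ) := by
  have h1 := Finset.sum_update_of_mem (Finset.mem_univ j) (fun i => (lower j α i : ℕ))
    ((lower j α j : ℕ) + 1)
  rw [← coe_eq_update_lower h] at h1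
  rw [h1, ← Finset.add_sum_erase _ _ (Finset.mem_univ j), Finset.erase_eq]
  ring

theorem lower_injOn {d N : ℕ} (j : Fin d) :
    Set.InjOn (lower (N := N) j) {α | (α j : ℕ) ≠ 0} := fun α hα β hβ h => by
  rw [← raise_lower hα, h, raise_lower hβ]

variable {H : Type*} [NormedAddCommGroup H] [InnerProductSpace ℂ H]

/-- Evaluation at `T` of the part of degree at most `k` of a polynomial, applied to `v`. -/
noncomputable def truncEval {d : ℕ} (N : ℕ) (T : Fin d → H →L[ℂ] H) (v : H) (k : ℕ) :
    ((Fin d → Fin (N + 1)) → ℂ) →ₗ[ℂ] H :=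
  ∑ α : Fin d → Fin (N + 1) with ∑ j, (α j : ℕ) ≤ k,
    (LinearMap.proj α).smulRight (tupleMonomial T (fun j => (α j : ℕ)) v)

theorem truncEval_apply {d N : ℕ} (T : Fin d → H →L[ℂ] H) (v : H) (k : ℕ)
    (g : (Fin d → Fin (N + 1)) → ℂ) : truncEval N T v k g =
      ∑ α : Fin d → Fin (N + 1) with ∑ j, (α j : ℕ) ≤ k,
        g α • tupleMonomial T (fun j => (α j : ℕ)) v := by
  simp [truncEval]

theorem truncEval_zero_gridShift {d N : ℕ} (T : Fin d → H →L[ℂ] H) (v : H) (j : Fin d)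
    (g : (Fin d → Fin (N + 1)) → ℂ) : truncEval N T v 0 (gridShift d N 0 j g) = 0 := by
  rw [truncEval_apply]
  refine Finset.sum_eq_zero fun α hα => ?_
  have h0 : (α j : ℕ) = 0 := by
    simp only [Finset.mem_filter, Finset.mem_univ, true_and, Nat.le_zero,
      Finset.sum_eq_zero_iff] at hα
    exact hα j trivial
  simp [gridShift_apply, h0]

/-- Multiplication by `z_j` raises the degree by one. Since `k < N`, a monomial of degree at most
`k` stays in the box, so the truncation loses nothing. -/
theorem truncEval_succ_gridShift {d N k : ℕ} {T : Fin d → H →L[ℂ] H} (hT : IsCommuting T) (v : H)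
    (hk : k < N) (j : Fin d) (g : (Fin d → Fin (N + 1)) → ℂ) :
    truncEval N T v (k + 1) (gridShift d N 0 j g) = T j (truncEval N T v k g) := by
  rw [truncEval_apply, truncEval_apply, map_sum]
  simp only [gridShift_apply, zero_mul, add_zero, ite_smul, zero_smul, map_smul]
  simp_rw [← ite_not (p := (_ : ℕ) = 0)]
  rw [← Finset.sum_filter, Finset.filter_filter]
  have hlt : ∀ β : Fin d → Fin (N + 1), ∑ i, (β i : ℕ) ≤ k → (β j : ℕ) < N := fun β hβ =>
    ((Finset.single_le_sum (f := fun i => (β i : ℕ)) (fun _ _ => Nat.zero_le _)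
      (Finset.mem_univ j)).trans hβ).trans_lt hk
  refine Finset.sum_nbij' (lower j) (raise j) (fun α hα => ?_) (fun β hβ => ?_) (fun α hα => ?_)
    (fun β hβ => ?_) fun α hα => ?_
  · simp only [Finset.mem_filter, Finset.mem_univ, true_and] at hα ⊢
    have := sum_lower_add_one hα.2
    omega
  · simp only [Finset.mem_filter, Finset.mem_univ, true_and] at hβ ⊢
    have h0 := raise_same_ne_zero (hlt β hβ)
    have := sum_lower_add_one h0
    rw [lower_raise (hlt β hβ)] at this
    exact ⟨by omega, h0⟩
  · exact raise_lower (Finset.mem_filter.1 hα).2.2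
  · exact lower_raise (hlt β (Finset.mem_filter.1 hβ).2)
  · rw [coe_eq_update_lower (Finset.mem_filter.1 hα).2.2, tupleMonomial_update_add_one hT]
    rfl

theorem truncEval_single {d N : ℕ} (T : Fin d → H →L[ℂ] H) (v : H) (k : ℕ) :
    truncEval N T v k (Pi.single 0 1) = v := by
  rw [truncEval_apply, Finset.sum_eq_single 0]
  · simp [tupleMonomial]
  · intro α _ hα
    simp [hα]
  · simp

/-- Monomials in operators that intertwine with shifted operators. -/
theorem shift_intertwine_tupleMonomial {E : Type*} [AddCommGroup E] [Module ℂ E] {N : ℕ}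
    {c : ℕ → E → H} {d : ℕ} {S : Fin d → Module.End ℂ E} {T : Fin d → H →L[ℂ] H}
    (h0 : ∀ j g, c 0 (S j g) = 0) (hs : ∀ j g, ∀ k < N, c (k + 1) (S j g) = T j (c k g))
    (α : Fin d → ℕ) (g : E) (k : ℕ) (hk : k ≤ N) :
    c k (tupleMonomial S α g) =
      if ∑ j, α j ≤ k then tupleMonomial T α (c (k - ∑ j, α j) g) else 0 := by
  induction d generalizing k with
  | zero => simp [tupleMonomial]
  | succ d ih =>
    have hp : ∀ n g, ∀ k ≤ N, c k ((S 0 ^ n) g) =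
        if n ≤ k then (T 0 ^ n) (c (k - n) g) else 0 := by
      intro n
      induction n with
      | zero => simp
      | succ n ihn =>
        intro g k hk
        rw [pow_succ', Module.End.mul_apply]
        cases k with
        | zero => simp [h0]
        | succ k =>
          rw [hs _ _ _ (by omega), ihn _ _ (by omega)]
          simp only [Nat.add_le_add_iff_right, Nat.add_sub_add_right]
          split_ifs
          · rw [pow_succ']; rfl
          · simp
    have ih' := ih (S := Fin.tail S) (T := Fin.tail T) (fun j => h0 j.succ) (fun j => hs j.succ)
      (Fin.tail α)
    have hsum : ∑ j, Fin.tail α j = ∑ j : Fin d, α j.succ := rfl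
    rw [tupleMonomial_succ, tupleMonomial_succ, Fin.sum_univ_succ, Module.End.mul_apply, hp _ _ _ hk]
    by_cases h : α 0 ≤ k
    · rw [if_pos h, ih' _ (by omega), hsum, Nat.sub_sub]
      by_cases h' : ∑ j : Fin d, α j.succ ≤ k - α 0
      · rw [if_pos h', if_pos (by omega)]; rfl
      · rw [if_neg h', if_neg (by omega), map_zero]
    · rw [if_neg h, if_neg (by omega)]

theorem truncEval_tupleMonomial {d N : ℕ} {T : Fin d → H →L[ℂ] H} (hT : IsCommuting T) (v : H)
    (α : Fin d → ℕ) {k : ℕ} (hk : k ≤ N) :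
    truncEval N T v k (tupleMonomial (gridShift d N 0) α (Pi.single 0 1)) =
      if ∑ j, α j ≤ k then tupleMonomial T α v else 0 := by
  rw [shift_intertwine_tupleMonomial (c := fun k g => truncEval N T v k g)
    (truncEval_zero_gridShift T v)
    (fun j g k hk => truncEval_succ_gridShift hT v hk j g) α _ k hk]
  simp only [truncEval_single]

/-! ### The Hilbert norm on polynomials. -/

/-- An embedding of polynomials into a Hilbert space, for which the coordinate shifts become strict
contractions. -/
noncomputable def polyEmbedding {d : ℕ} (N : ℕ) (T : Fin d → H →L[ℂ] H) (v : H) (ρ : ℝ) :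
    ((Fin d → Fin (N + 1)) → ℂ) →ₗ[ℂ]
      PiLp 2 fun _ : Fin (N + 1) ⊕ (Fin d → Fin (N + 1)) => H :=
  (WithLp.linearEquiv 2 ℂ _).symm.toLinearMap ∘ₗ LinearMap.pi (Sum.elim
    (fun k => truncEval N T v k)
    fun α => ((ρ : ℂ) ^ ∑ j, (α j : ℕ)) • (LinearMap.proj α).smulRight v)

theorem norm_polyEmbedding_sq {d N : ℕ} (T : Fin d → H →L[ℂ] H) (v : H) {ρ : ℝ} (hρ : 0 < ρ)
    (g : (Fin d → Fin (N + 1)) → ℂ) : ‖polyEmbedding N T v ρ g‖ ^ 2 =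
      ∑ k : Fin (N + 1), ‖truncEval N T v k g‖ ^ 2 +
        ∑ α : Fin d → Fin (N + 1), (ρ ^ (∑ j, (α j : ℕ)) * (‖g α‖ * ‖v‖)) ^ 2 := by
  rw [PiLp.norm_sq_eq_of_L2, Fintype.sum_sum_type]
  simp [polyEmbedding, norm_smul, abs_of_pos hρ]

/-- The weighted coefficient block alone determines `g`; definiteness is its whole purpose. -/
theorem polyEmbedding_injective {d N : ℕ} (T : Fin d → H →L[ℂ] H) {v : H} (hv : v ≠ 0) {ρ : ℝ}
    (hρ : 0 < ρ) : Function.Injective (polyEmbedding N T v ρ) := by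
  rw [injective_iff_map_eq_zero]
  intro g hg
  have h := norm_polyEmbedding_sq T v hρ g
  rw [hg, norm_zero, zero_pow two_ne_zero, eq_comm, add_eq_zero_iff_of_nonneg
    (Finset.sum_nonneg fun _ _ => by positivity) (Finset.sum_nonneg fun _ _ => by positivity),
    Finset.sum_eq_zero_iff_of_nonneg (s := (Finset.univ : Finset (Fin d → Fin (N + 1))))
      (fun _ _ => by positivity)] at h
  funext α
  simpa [hv, hρ.ne'] using h.2 α (Finset.mem_univ α)

theorem norm_polyEmbedding_gridShift_le {d N : ℕ} {T : Fin d → H →L[ℂ] H} (hT : IsCommuting T)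
    (v : H) {ρ : ℝ} (hρ : 0 < ρ) (hTρ : ∀ j, ‖T j‖ ≤ ρ) (j : Fin d)
    (g : (Fin d → Fin (N + 1)) → ℂ) :
    ‖polyEmbedding N T v ρ (gridShift d N 0 j g)‖ ≤ ρ * ‖polyEmbedding N T v ρ g‖ := by
  refine le_of_sq_le_sq ?_ (by positivity)
  rw [mul_pow, norm_polyEmbedding_sq T v hρ, norm_polyEmbedding_sq T v hρ, mul_add]
  refine add_le_add ?_ ?_
  -- The term `k = 0` of the shifted polynomial vanishes, term `k + 1` is matched with term `k` of
  -- `g`, and the last term of `g` is discarded.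
  · rw [Fin.sum_univ_succ, Fin.sum_univ_castSucc (n := N), mul_add, Finset.mul_sum]
    simp only [Fin.val_zero, truncEval_zero_gridShift, norm_zero, ne_eq, OfNat.ofNat_ne_zero,
      not_false_eq_true, zero_pow, zero_add, Fin.val_succ, Fin.val_castSucc]
    refine le_add_of_le_of_nonneg (Finset.sum_le_sum fun k _ => ?_) (by positivity)
    rw [truncEval_succ_gridShift hT v k.2, ← mul_pow]
    exact pow_le_pow_left₀ (norm_nonneg _) ((T j).le_of_opNorm_le (hTρ j) _) 2
  · let F : (Fin d → Fin (N + 1)) → ℝ := fun α => (ρ ^ (∑ j, (α j : ℕ)) * (‖g α‖ * ‖v‖)) ^ 2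
    have hF : ∀ α, (ρ ^ (∑ j, (α j : ℕ)) * (‖gridShift d N 0 j g α‖ * ‖v‖)) ^ 2 =
        if (α j : ℕ) ≠ 0 then ρ ^ 2 * F (lower j α) else 0 := by
      intro α
      split_ifs with h
      · simp only [gridShift_apply, h, if_false, zero_mul, add_zero, F, ← sum_lower_add_one h,
          pow_succ ρ]
        ring
      · simp only [not_not] at h
        simp [gridShift_apply, h]
    simp only [hF]
    let A : Finset (Fin d → Fin (N + 1)) := {α | (α j : ℕ) ≠ 0}
    -- By injectivity the shifted coefficient sum is `ρ²` times a subsum of the one for `g`.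
    have hinj : Set.InjOn (lower j) (A : Set (Fin d → Fin (N + 1))) := by
      refine (lower_injOn j).mono fun α hα => ?_
      simpa [A] using hα
    rw [← Finset.sum_filter, ← Finset.mul_sum, ← Finset.sum_image (f := F) hinj]
    exact mul_le_mul_of_nonneg_left (Finset.sum_le_sum_of_subset_of_nonneg (Finset.subset_univ _)
      fun _ _ _ => by positivity) (by positivity)

/-- Each of the `N + 1` truncations contributes `‖v‖²`, and the coefficient block one more. -/
theorem norm_polyEmbedding_single_sq {d N : ℕ} (T : Fin d → H →L[ℂ] H) (v : H) {ρ : ℝ}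
    (hρ : 0 < ρ) :
    ‖polyEmbedding N T v ρ (Pi.single 0 1)‖ ^ 2 = (N + 2) * ‖v‖ ^ 2 := by
  rw [norm_polyEmbedding_sq T v hρ, Finset.sum_eq_single (0 : Fin d → Fin (N + 1))
    (fun α _ hα => by simp [hα]) (by simp)]
  simp [truncEval_single]
  ring

/-! ### From strict contractions to nilpotent and diagonalizable matrices. -/

/-- If the averages of a sequence tend to something larger than `a`, then its partial sums exceed
`a` times the number of terms, even with one extra term. -/
theorem exists_mul_lt_sum_range {u : ℕ → ℝ} {a l : ℝ} (hu : Tendsto u atTop (𝓝 l)) (h : a < l) :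
    ∃ N : ℕ, a * (N + 2) < ∑ k ∈ Finset.range (N + 1), u k := by
  obtain ⟨m, ham, hml⟩ := exists_between h
  have h1 := hu.cesaro.eventually_const_lt hml
  -- With `n = N + 1` this says `n (m - a) > a`, so the gap between `m` and `a` pays for the extra
  -- term.
  have h2 : ∀ᶠ n : ℕ in atTop, a / (m - a) < n :=
    tendsto_natCast_atTop_atTop.eventually_gt_atTop _
  obtain ⟨N, hN1, hN2⟩ := ((tendsto_add_atTop_nat 1).eventually (h1.and h2)).exists
  refine ⟨N, ?_⟩
  have hpos : (0 : ℝ) < (N + 1 : ℕ) := by positivity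
  rw [lt_inv_mul_iff₀ hpos] at hN1
  rw [div_lt_iff₀ (sub_pos.2 ham)] at hN2
  push_cast at hN1 hN2
  linarith

/-- Strict contractions can be replaced by the nilpotent coordinate shifts on a space of
polynomials, for a suitable Hilbert space norm. -/
theorem exists_gridShift_model {d : ℕ} {f : (Fin d → ℂ) → ℂ}
    (hf : AnalyticOnNhd ℂ f (polydisc d)) [CompleteSpace H] {T : Fin d → H →L[ℂ] H}
    (hT : IsCommuting T) (hT1 : ∀ j, ‖T j‖ < 1) {c : ℝ} (hc : 0 < c) (h : c < ‖evalTuple f T‖) :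
    ∃ (N n : ℕ) (e : ((Fin d → Fin (N + 1)) → ℂ) ≃ₗ[ℂ] EuclideanSpace ℂ (Fin n)) (ρ : ℝ),
      0 < ρ ∧ ρ < 1 ∧ (∀ j, ‖toMatOp e (gridShift d N 0 j)‖ ≤ ρ) ∧
      c < ‖evalTuple f fun j => toMatOp e (gridShift d N 0 j)‖ := by
  obtain ⟨ρ, hρ, hρ1, hTρ⟩ := exists_uniform_bound_lt_one hT1
  obtain ⟨v, hv⟩ : ∃ v, c * ‖v‖ < ‖evalTuple f T v‖ := by
    by_contra! hle
    exact h.not_ge (ContinuousLinearMap.opNorm_le_bound _ hc.le hle)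
  have hv0 : v ≠ 0 := fun h0 => by simp [h0] at hv
  have hsumT := summable_evalTuple (ContinuousLinearMap.norm_id_le) hf hρ.le hρ1 hTρ
  -- `s k` is the part of `f(T)v` of total degree at most `k`.
  let s : ℕ → H := fun k => ∑' α : Fin d → ℕ,
    taylorCoeff d f α • if ∑ j, α j ≤ k then tupleMonomial T α v else 0
  have hs : Tendsto s atTop (𝓝 (evalTuple f T v)) := by
    have heval : evalTuple f T v = ∑' α, taylorCoeff d f α • tupleMonomial T α v :=
      (ContinuousLinearMap.apply ℂ H v).map_tsum hsumT.of_norm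
    rw [heval]
    refine tendsto_tsum_of_dominated_convergence (hsumT.mul_right ‖v‖) (fun α => ?_)
      (.of_forall fun k α => ?_)
    · refine tendsto_const_nhds.congr' ?_
      filter_upwards [eventually_ge_atTop (∑ j, α j)] with k hk
      rw [if_pos hk]
    · split_ifs
      · exact (taylorCoeff d f α • tupleMonomial T α).le_opNorm v
      · simpa using by positivity
  obtain ⟨N, hN⟩ := exists_mul_lt_sum_range (a := (c * ‖v‖) ^ 2) (hs.norm.pow 2)
    (pow_lt_pow_left₀ hv (by positivity) two_ne_zero)
  obtain ⟨n, e, he⟩ := exists_equiv_euclideanSpace (polyEmbedding N T v ρ)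
    (polyEmbedding_injective T hv0 hρ)
  have hS : ∀ j, ‖toMatOp e (gridShift d N 0 j)‖ ≤ ρ := fun j =>
    ContinuousLinearMap.opNorm_le_bound _ hρ.le fun x => by
      have := norm_polyEmbedding_gridShift_le hT v hρ hTρ j (e.symm x)
      rwa [← he, ← he, e.apply_symm_apply] at this
  refine ⟨N, n, e, ρ, hρ, hρ1, hS, ?_⟩
  set X := evalTuple f fun j => toMatOp e (gridShift d N 0 j) with hX
  have hsumS := summable_evalTuple (ContinuousLinearMap.norm_id_le) hf hρ.le hρ1 hS
  -- `Pi.single 0 1` is the constant polynomial 1, so the truncations of `f(S)1` evaluate at `T` to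
  -- those of `f`.
  have hXs : ∀ k ≤ N, truncEval N T v k (e.symm (X (e (Pi.single 0 1)))) = s k := by
    intro k hk
    let L : MatOp n →L[ℂ] H :=
      (LinearMap.toContinuousLinearMap (truncEval N T v k ∘ₗ e.symm.toLinearMap)) ∘L
        ContinuousLinearMap.apply ℂ (EuclideanSpace ℂ (Fin n)) (e (Pi.single 0 1))
    refine (L.map_tsum hsumS.of_norm).trans (tsum_congr fun α => ?_)
    rw [map_smul, ← map_tupleMonomial (toMatOp e)]
    congr 1
    rw [← truncEval_tupleMonomial hT v α hk]
    simp [L]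
  by_contra! hle
  have h1 : ‖X (e (Pi.single 0 1))‖ ≤ c * ‖e (Pi.single 0 1)‖ := X.le_of_opNorm_le hle _
  have h2 := pow_le_pow_left₀ (norm_nonneg _) h1 2
  rw [← e.apply_symm_apply (X _), he, he, mul_pow, norm_polyEmbedding_single_sq T v hρ,
    norm_polyEmbedding_sq T v hρ] at h2
  rw [← Fin.sum_univ_eq_sum_range (fun k => ‖s k‖ ^ 2)] at hN
  have h3 : ∑ k : Fin (N + 1), ‖truncEval N T v k (e.symm (X (e (Pi.single 0 1))))‖ ^ 2 =
      ∑ k : Fin (N + 1), ‖s k‖ ^ 2 :=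
    Finset.sum_congr rfl fun k _ => by rw [hXs k (Nat.lt_succ_iff.1 k.2)]
  have h4 : 0 ≤ ∑ α : Fin d → Fin (N + 1), (ρ ^ (∑ j, (α j : ℕ)) *
      (‖(e.symm (X (e (Pi.single 0 1)))) α‖ * ‖v‖)) ^ 2 :=
    Finset.sum_nonneg fun _ _ => by positivity
  rw [h3] at h2
  nlinarith

/-- The nilpotent coordinate shifts can be perturbed to simultaneously diagonalizable tuples. -/
theorem exists_isSimultaneouslyDiagonalizable {d N n : ℕ} {f : (Fin d → ℂ) → ℂ}
    (hf : AnalyticOnNhd ℂ f (polydisc d))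
    (e : ((Fin d → Fin (N + 1)) → ℂ) ≃ₗ[ℂ] EuclideanSpace ℂ (Fin n)) {ρ c : ℝ} (hρ : 0 < ρ)
    (hρ1 : ρ < 1) (hS : ∀ j, ‖toMatOp e (gridShift d N 0 j)‖ ≤ ρ)
    (h : c < ‖evalTuple f fun j => toMatOp e (gridShift d N 0 j)‖) :
    ∃ T : Fin d → MatOp n, IsCommuting T ∧ (∀ j, ‖T j‖ ≤ 1) ∧ IsSimultaneouslyDiagonalizable T ∧
      jointSpectrum T ⊆ polydisc d ∧ c < ‖evalTuple f T‖ := by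
  -- The room between `ρ` and `r` absorbs the perturbation; `r < 1` also keeps the joint eigenvalues
  -- in the polydisc.
  obtain ⟨r, hρr, hr1⟩ := exists_between hρ1
  let D : ℂ → Fin d → MatOp n := fun t j => toMatOp e (gridShift d N t j)
  have hD : Continuous D := by
    refine continuous_pi fun j => ?_
    have : (fun t => D t j) = fun t => toMatOp e (gridShift d N 0 j) +
        t • toMatOp e (gridShift d N 1 j - gridShift d N 0 j) := funext fun t => by
      simp only [D]
      rw [gridShift_eq_add_smul t j, map_add, map_smul]
    rw [this]
    exact continuous_const.add (continuous_id.smul continuous_const)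
  have hlim : Tendsto D (𝓝[≠] 0) (𝓝 (D 0)) := (hD.tendsto 0).mono_left nhdsWithin_le_nhds
  have hnorm : ∀ᶠ t in 𝓝[≠] (0 : ℂ), ∀ j, ‖D t j‖ ≤ r := eventually_all.2 fun j =>
    (((continuous_apply j).tendsto _).comp hlim).norm.eventually_le_const ((hS j).trans_lt hρr)
  have hval := (tendsto_evalTuple ContinuousLinearMap.norm_id_le hf (hρ.trans hρr).le hr1 hnorm
    hlim).norm.eventually_const_lt h
  obtain ⟨t, ⟨htr, htc⟩, ht⟩ := ((hnorm.and hval).and self_mem_nhdsWithin).exists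
  refine ⟨D t, fun i j => (gridShift_commute t i j).map (toMatOp e), fun j => (htr j).trans hr1.le,
    isSimultaneouslyDiagonalizable_gridShift ht e, ?_, htc⟩
  rintro μ ⟨x, hx, hμ⟩ j
  have := (D t j).le_of_opNorm_le (htr j) x
  rw [hμ j, norm_smul] at this
  exact (le_of_mul_le_mul_right this (norm_pos_iff.2 hx)).trans_lt hr1

end AglerNorm

theorem corollary6 (d : ℕ) (f : (Fin d → ℂ) → ℂ)
    (hf : AnalyticOnNhd ℂ f (AglerNorm.polydisc d)) (c : ℝ) (hc : 0 < c) :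
    List.TFAE [
      ENNReal.ofReal c < AglerNorm.aglerNorm.{u} f,
      ∃ (n : ℕ) (T : Fin d → AglerNorm.MatOp n),
        AglerNorm.IsCommuting T ∧ (∀ j, ‖T j‖ ≤ 1) ∧
        AglerNorm.IsSimultaneouslyDiagonalizable T ∧
        AglerNorm.jointSpectrum T ⊆ AglerNorm.polydisc d ∧
        c < ‖AglerNorm.evalTuple f T‖,
      ∃ (n : ℕ) (M : Fin d → AglerNorm.MatOp n),
        AglerNorm.IsCommuting M ∧ (∀ j, ‖M j‖ ≤ 1) ∧
        (∀ j, IsNilpotent (M j)) ∧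
        c < ‖AglerNorm.evalTuple f M‖] := by
  have model : ENNReal.ofReal c < AglerNorm.aglerNorm.{u} f →
      ∃ (N n : ℕ) (e : ((Fin d → Fin (N + 1)) → ℂ) ≃ₗ[ℂ] EuclideanSpace ℂ (Fin n)) (ρ : ℝ),
        0 < ρ ∧ ρ < 1 ∧ (∀ j, ‖AglerNorm.toMatOp e (AglerNorm.gridShift d N 0 j)‖ ≤ ρ) ∧
        c < ‖AglerNorm.evalTuple f fun j =>
          AglerNorm.toMatOp e (AglerNorm.gridShift d N 0 j)‖ := by
    intro h
    simp only [AglerNorm.aglerNorm, lt_iSup_iff] at h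
    obtain ⟨H, i1, i2, i3, T, hT, hT1, h⟩ := h
    rw [← ofReal_norm] at h
    exact AglerNorm.exists_gridShift_model hf hT hT1 hc (lt_of_not_ge fun hle =>
      h.not_ge (ENNReal.ofReal_le_ofReal hle))
  tfae_have 1 → 2 := fun h => by
    obtain ⟨N, n, e, ρ, hρ, hρ1, hS, h⟩ := model h
    exact ⟨n, AglerNorm.exists_isSimultaneouslyDiagonalizable hf e hρ hρ1 hS h⟩
  tfae_have 1 → 3 := fun h => by
    obtain ⟨N, n, e, ρ, hρ, hρ1, hS, h⟩ := model h
    exact ⟨n, _, fun i j => (AglerNorm.gridShift_commute 0 i j).map (AglerNorm.toMatOp e),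
      fun j => (hS j).trans hρ1.le,
      fun j => (AglerNorm.isNilpotent_gridShift_zero j).map (AglerNorm.toMatOp e), h⟩
  tfae_have 2 → 1 := fun ⟨n, T, hT, hT1, hdiag, hσ, h⟩ =>
    AglerNorm.ofReal_lt_aglerNorm hT hT1
      (AglerNorm.summable_evalTuple_of_isSimultaneouslyDiagonalizable hf hdiag hσ) hc h
  tfae_have 3 → 1 := fun ⟨n, M, hM, hM1, hnil, h⟩ =>
    AglerNorm.ofReal_lt_aglerNorm hM hM1
      (AglerNorm.summable_evalTuple_of_isNilpotent f hnil) hc h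
  tfae_finish
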